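/- Let $M$ be a finite-dimensional smooth manifold (without boundary) with a smooth pseudo-Riemannian (symmetric, nondegenerate) metric $T_2$, and let $\pi\colon TM\to M$ be its tangent bundle. Let $\theta$ be the 1-form on $TM$ given by $\theta_v(\xi)=T_2(v,\pi_*\xi)$ for $v\in TM$, $\xi\in T_v(TM)$; put $\omega_2=d\theta$, and let $T\colon TM\to\mathbb{R}$, $T(v)=\tfrac12T_2(v,v)$, be the kinetic energy. Exterior differentials are normalized by $d\beta(X,Y)=X(\beta(Y))-Y(\beta(X))-\beta([X,Y])$, and $i_X$ denotes contraction with $X$ in the first argument. A *force form* is a smooth 1-form $\alpha$ on $TM$ that is horizontal, i.e. vanishes on the vectors $\xi$ with $\pi_*\xi=0$; it is *independent of the velocity* if $\alpha=\pi^*a$ for a smooth 1-form $a$ on $M$. The *equation of motion* of the mechanical system $(M,T_2,\alpha)$ is the second-order differential equation $D$ (a smooth vector field $D$ on $TM$ with $\pi_*(D_v)=v$ for all $v\in TM$) that satisfies Newton's equation $$i_D\omega_2+dT+\alpha=0 .$$ A smooth vector field $u$ on $M$ is an *intermediate integral* of $(M,T_2,\alpha)$ if $D$ is tangent to the section $u\colon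 M\to TM$, i.e. $D_{u(x)}\in u_*(T_xM)$ for every $x\in M$. **Theorem.** For every smooth vector field $u$ on $M$ there is exactly one force form $\alpha$ that is independent of the velocity and for which $u$ is an intermediate integral of the mechanical system $(M,T_2,\alpha)$. It is given by $$\alpha=\pi^*\bigl(-\,i_u\,d(i_uT_2)-d(T(u))\bigr),$$ where $T(u)=T\circ u$ is the function $x\mapsto\tfrac12T_2(u_x,u_x)$ on $M$. -/

import Mathlib

open scoped Manifold ContDiff Bundle

noncomputable section

namespace Mechanics

/-! ### One-forms on a manifold -/

section Forms

variable {F : Type*} [NormedAddCommGroup F] [NormedSpace ℝ F]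
  {G : Type*} [TopologicalSpace G] (J : ModelWithCorners ℝ F G)
  {N : Type*} [TopologicalSpace N] [ChartedSpace G N]

/-- A (not necessarily smooth) field of covectors on the manifold `N`. -/
abbrev CovectorField (J : ModelWithCorners ℝ F G) (N : Type*) [TopologicalSpace N]
    [ChartedSpace G N] :=
  ∀ x : N, TangentSpace J x →L[ℝ] ℝ

/-- A (not necessarily smooth) field of tangent vectors on the manifold `N`. -/
abbrev VectorField (J : ModelWithCorners ℝ F G) (N : Type*) [TopologicalSpace N]
    [ChartedSpace G N] :=
  ∀ x : N, TangentSpace J x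

/-- A covector field is a (smooth) differential 1-form if it is a smooth section of the
cotangent bundle. -/
def IsSmoothForm [IsManifold J ∞ N] (β : CovectorField J N) : Prop :=
  ContMDiff J (J.prod 𝓘(ℝ, F →L[ℝ] ℝ)) ∞
    (fun x ↦ Bundle.TotalSpace.mk' (F →L[ℝ] ℝ)
      (E := fun x : N ↦ TangentSpace J x →L[ℝ] Bundle.Trivial N ℝ x) x (β x))

/-- A vector field is smooth if it is a smooth section of the tangent bundle. -/
def IsSmoothField [IsManifold J ∞ N] (X : VectorField J N) : Prop :=
  ContMDiff J J.tangent ∞ (fun x ↦ (⟨x, X x⟩ : TangentBundle J N))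

/-- The coordinate expression of a covector field `β` in the chart `φ` around `x₀`: the pull-back
of `β` by `φ⁻¹`. -/
def formInChart (β : CovectorField J N) (x₀ : N) (y : F) : F →L[ℝ] ℝ :=
  (β ((extChartAt J x₀).symm y)).comp
    (mfderivWithin 𝓘(ℝ, F) J (extChartAt J x₀).symm (Set.range J) y)

/-- The exterior differential `dβ` of a 1-form `β` on a manifold, evaluated at two tangent vectors
`v`, `w` at `x`. It is the exterior differential of the coordinate expression of `β` in the chart
around `x`, so that `dβ(X, Y) = X(β(Y)) - Y(β(X)) - β([X, Y])`. -/
def extDiff (β : CovectorField J N) (x : N) (v w : TangentSpace J x) : ℝ :=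
  extDerivWithin
    (fun y ↦ ContinuousAlternatingMap.ofSubsingleton ℝ F ℝ (0 : Fin 1) (formInChart J β x y))
    (Set.range J) (extChartAt J x x)
    ![mfderiv J 𝓘(ℝ, F) (extChartAt J x) x v, mfderiv J 𝓘(ℝ, F) (extChartAt J x) x w]

end Forms

section Mechanics

variable (E : Type*) [NormedAddCommGroup E] [NormedSpace ℝ E]
  (M : Type*) [TopologicalSpace M] [ChartedSpace E M] [IsManifold 𝓘(ℝ, E) ∞ M]

/-- A smooth pseudo-Riemannian (nondegenerate, of arbitrary signature) metric on `M`. -/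
structure PseudoRiemannianMetric where
  /-- The scalar product on each tangent space. -/
  inner (x : M) : TangentSpace 𝓘(ℝ, E) x →L[ℝ] TangentSpace 𝓘(ℝ, E) x →L[ℝ] ℝ
  symm (x : M) (v w : TangentSpace 𝓘(ℝ, E) x) : inner x v w = inner x w v
  nondegenerate (x : M) (v : TangentSpace 𝓘(ℝ, E) x) (hv : ∀ w, inner x v w = 0) : v = 0
  contMDiff : ContMDiff 𝓘(ℝ, E) (𝓘(ℝ, E).prod 𝓘(ℝ, E →L[ℝ] E →L[ℝ] ℝ)) ∞
    (fun x ↦ Bundle.TotalSpace.mk' (E →L[ℝ] E →L[ℝ] ℝ)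
      (E := fun x : M ↦ TangentSpace 𝓘(ℝ, E) x →L[ℝ] TangentSpace 𝓘(ℝ, E) x →L[ℝ] ℝ)
      x (inner x))

/-- The tangent bundle `TM`. -/
abbrev TM := TangentBundle 𝓘(ℝ, E) M

variable {E M}

/-- The differential `π_*` of the projection `π : TM → M` at `p`. -/
def projDiff (p : TM E M) :
    TangentSpace 𝓘(ℝ, E).tangent p →L[ℝ] TangentSpace 𝓘(ℝ, E) p.proj :=
  mfderiv 𝓘(ℝ, E).tangent 𝓘(ℝ, E) (fun q : TM E M ↦ q.proj) p

/-- The vector field `u`, as the section `x ↦ u_x` of `TM → M`. -/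
def toSection (u : VectorField 𝓘(ℝ, E) M) (x : M) : TM E M := ⟨x, u x⟩

/-- A tangent vector of `TM` is vertical if it is tangent to the fibres of `TM → M`. -/
def IsVertical {p : TM E M} (ξ : TangentSpace 𝓘(ℝ, E).tangent p) : Prop :=
  projDiff p ξ = 0

/-- A force form (work form): a smooth 1-form on `TM` which is horizontal, that is, annihilates
the vertical vectors. -/
structure IsForceForm (α : CovectorField 𝓘(ℝ, E).tangent (TM E M)) : Prop where
  smooth : IsSmoothForm 𝓘(ℝ, E).tangent α
  horizontal : ∀ (p : TM E M) (ξ : TangentSpace 𝓘(ℝ, E).tangent p), IsVertical ξ → α p ξ = 0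

/-- A 1-form on `TM` is independent of the velocities if it is the pull-back of a smooth 1-form
on `M` by the projection `TM → M`. -/
def IsVelocityIndependent (α : CovectorField 𝓘(ℝ, E).tangent (TM E M)) : Prop :=
  ∃ a : CovectorField 𝓘(ℝ, E) M, IsSmoothForm 𝓘(ℝ, E) a ∧
    ∀ (p : TM E M) (ξ : TangentSpace 𝓘(ℝ, E).tangent p), α p ξ = a p.proj (projDiff p ξ)

/-- A second order differential equation on `M`: a smooth vector field `D` on `TM` with
`π_*(D_v) = v` for every `v` in `TM`. -/
structure IsSecondOrderEquation (D : VectorField 𝓘(ℝ, E).tangent (TM E M)) : Prop where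
  smooth : IsSmoothField 𝓘(ℝ, E).tangent D
  second_order : ∀ p : TM E M, projDiff p (D p) = p.snd

namespace PseudoRiemannianMetric

variable (g : PseudoRiemannianMetric E M)

/-- The Liouville form on `TM`: `θ_v = i_v T₂`, lifted to `TM`. -/
def liouville : CovectorField 𝓘(ℝ, E).tangent (TM E M) :=
  fun p ↦ (g.inner p.proj p.snd).comp (projDiff p)

/-- The symplectic form `ω₂ = dθ` on `TM`. -/
def symplectic (p : TM E M) (ξ η : TangentSpace 𝓘(ℝ, E).tangent p) : ℝ :=
  extDiff 𝓘(ℝ, E).tangent g.liouville p ξ η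

/-- The kinetic energy `T(v) = ½ T₂(v, v)`. -/
def kinetic (p : TM E M) : ℝ := (1 / 2) * g.inner p.proj p.snd p.snd

/-- The 1-form `i_u T₂` on `M`. -/
def lower (u : VectorField 𝓘(ℝ, E) M) : CovectorField 𝓘(ℝ, E) M :=
  fun x ↦ g.inner x (u x)

/-- `D` is the equation of motion of the mechanical system `(M, T₂, α)`: the second order
differential equation that satisfies Newton's equation `i_D ω₂ + dT + α = 0`. -/
structure IsEquationOfMotion (α : CovectorField 𝓘(ℝ, E).tangent (TM E M))
    (D : VectorField 𝓘(ℝ, E).tangent (TM E M)) : Prop where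
  isSecondOrderEquation : IsSecondOrderEquation D
  newton : ∀ (p : TM E M) (ξ : TangentSpace 𝓘(ℝ, E).tangent p),
    g.symplectic p (D p) ξ + mvfderiv 𝓘(ℝ, E).tangent g.kinetic p ξ + α p ξ = 0

end PseudoRiemannianMetric

/-- The vector field `u` on `M` is an intermediate integral of the vector field `D` on `TM` if `D`
is tangent to the section `u` of `TM → M` at all of its points. -/
def IsIntermediateIntegral (D : VectorField 𝓘(ℝ, E).tangent (TM E M))
    (u : VectorField 𝓘(ℝ, E) M) : Prop :=
  ∀ x : M, ∃ w : TangentSpace 𝓘(ℝ, E) x,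
    D (toSection u x) = mfderiv 𝓘(ℝ, E) 𝓘(ℝ, E).tangent (toSection u) x w

/-- The vector field `u` on `M` is an intermediate integral of the mechanical system `(M, T₂, α)`
if it is one of its equation of motion. -/
def PseudoRiemannianMetric.IsIntermediateIntegralOfSystem (g : PseudoRiemannianMetric E M)
    (α : CovectorField 𝓘(ℝ, E).tangent (TM E M)) (u : VectorField 𝓘(ℝ, E) M) : Prop :=
  ∃ D : VectorField 𝓘(ℝ, E).tangent (TM E M),
    g.IsEquationOfMotion α D ∧ IsIntermediateIntegral D u

end Mechanics

end Mechanics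

end

noncomputable section

namespace Mechanics

open scoped Topology

section Charts

variable {F : Type*} [NormedAddCommGroup F] [NormedSpace ℝ F]
  {G : Type*} [TopologicalSpace G] (J : ModelWithCorners ℝ F G)
  {N : Type*} [TopologicalSpace N] [ChartedSpace G N]

/-- The differential at `x` of the chart around `x₀`. -/
def chartDiff (x₀ x : N) : TangentSpace J x →L[ℝ] F :=
  mfderiv J 𝓘(ℝ, F) (extChartAt J x₀) x

/-- The differential at `y` of the inverse of the chart around `x₀`. -/
def chartLift (x₀ : N) (y : F) : F →L[ℝ] TangentSpace J ((extChartAt J x₀).symm y) :=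
  mfderivWithin 𝓘(ℝ, F) J (extChartAt J x₀).symm (Set.range J) y

/-- The change of coordinates from the chart around `x₁` to the chart around `x₀`. -/
def chartChange (x₁ x₀ : N) : F → F := extChartAt J x₀ ∘ (extChartAt J x₁).symm

variable {J}

theorem formInChart_apply (β : CovectorField J N) (x₀ : N) (y v : F) :
    formInChart J β x₀ y v = β ((extChartAt J x₀).symm y) (chartLift J x₀ y v) := rfl

theorem exists_chart_point {x₀ x : N} (hx : x ∈ (extChartAt J x₀).source) :
    ∃ y ∈ (extChartAt J x₀).target, (extChartAt J x₀).symm y = x :=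
  ⟨_, (extChartAt J x₀).map_source hx, (extChartAt J x₀).left_inv hx⟩

variable [IsManifold J ∞ N]

theorem chartDiff_chartLift {x₀ : N} {y : F} (hy : y ∈ (extChartAt J x₀).target) (v : F) :
    chartDiff J x₀ ((extChartAt J x₀).symm y) (chartLift J x₀ y v) = v :=
  DFunLike.congr_fun (mfderiv_extChartAt_comp_mfderivWithin_extChartAt_symm (I := J) hy) v

theorem chartLift_chartDiff {x₀ : N} {y : F} (hy : y ∈ (extChartAt J x₀).target)
    (v : TangentSpace J ((extChartAt J x₀).symm y)) :
    chartLift J x₀ y (chartDiff J x₀ ((extChartAt J x₀).symm y) v) = v :=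
  DFunLike.congr_fun (mfderivWithin_extChartAt_symm_comp_mfderiv_extChartAt (I := J) hy) v

theorem chartDiff_self (x : N) (v : TangentSpace J x) : chartDiff J x x v = v :=
  DFunLike.congr_fun (mfderiv_extChartAt_self (I := J) (x := x)) v

theorem chartDiff_injective {x₀ x : N} (hx : x ∈ (extChartAt J x₀).source) :
    Function.Injective (chartDiff J x₀ x) := by
  obtain ⟨y, hy, rfl⟩ := exists_chart_point hx
  exact Function.LeftInverse.injective (chartLift_chartDiff hy)

theorem chartDiff_surjective {x₀ x : N} (hx : x ∈ (extChartAt J x₀).source) :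
    Function.Surjective (chartDiff J x₀ x) := by
  obtain ⟨y, hy, rfl⟩ := exists_chart_point hx
  exact Function.RightInverse.surjective (chartDiff_chartLift hy)

theorem covector_eq_formInChart (β : CovectorField J N) {x₀ x : N}
    (hx : x ∈ (extChartAt J x₀).source) (v : TangentSpace J x) :
    β x v = formInChart J β x₀ (extChartAt J x₀ x) (chartDiff J x₀ x v) := by
  obtain ⟨y, hy, rfl⟩ := exists_chart_point hx
  rw [(extChartAt J x₀).right_inv hy, formInChart_apply, chartLift_chartDiff hy]

theorem hasMFDerivAt_chart {x₀ x : N} (hx : x ∈ (extChartAt J x₀).source) :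
    HasMFDerivAt J 𝓘(ℝ, F) (extChartAt J x₀) x (chartDiff J x₀ x) :=
  (mdifferentiableAt_extChartAt (by rwa [← extChartAt_source J])).hasMFDerivAt

theorem contDiffOn_comp_chart_symm {V : Type*} [NormedAddCommGroup V] [NormedSpace ℝ V] {f : N → V}
    {x₀ : N} (hf : ContMDiffOn J 𝓘(ℝ, V) ∞ f (extChartAt J x₀).source) :
    ContDiffOn ℝ ∞ (f ∘ (extChartAt J x₀).symm) (extChartAt J x₀).target :=
  (hf.comp (contMDiffOn_extChartAt_symm x₀)
    fun _ hy ↦ (extChartAt J x₀).map_target hy).contDiffOn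

theorem trivializationAt_covector (β : CovectorField J N) {x₀ : N} {y : F}
    (hy : y ∈ (extChartAt J x₀).target) :
    (trivializationAt (F →L[ℝ] ℝ) (fun x : N ↦ TangentSpace J x →L[ℝ] Bundle.Trivial N ℝ x) x₀
      ⟨(extChartAt J x₀).symm y, β ((extChartAt J x₀).symm y)⟩).2 = formInChart J β x₀ y := by
  have hs : (extChartAt J x₀).symm y ∈ (chartAt G x₀).source := by
    rw [← extChartAt_source J]; exact (extChartAt J x₀).map_target hy
  rw [hom_trivializationAt_apply]
  ext v
  simp only [ContinuousLinearMap.inCoordinates]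
  have := TangentBundle.symmL_trivializationAt (I := J) hs
  rw [(extChartAt J x₀).right_inv hy] at this
  rw [this]
  simp
  rfl

theorem IsSmoothForm.contDiffOn {β : CovectorField J N} (hβ : IsSmoothForm J β) (x₀ : N) :
    ContDiffOn ℝ ∞ (formInChart J β x₀) (extChartAt J x₀).target := by
  have h := (Bundle.Trivialization.contMDiffOn_section_iff (IB := J) (n := ∞)
    (e := trivializationAt (F →L[ℝ] ℝ)
      (fun x : N ↦ TangentSpace J x →L[ℝ] Bundle.Trivial N ℝ x) x₀)
      (a := (extChartAt J x₀).source) (s := β) (isOpen_extChartAt_source x₀)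
      (fun x hx ↦ by simpa using hx)).1
      hβ.contMDiffOn
  exact (contDiffOn_comp_chart_symm h).congr fun y hy ↦ (trivializationAt_covector β hy).symm

/-- The coordinate expression of a vector field in the chart around `x₀`. -/
def fieldInChart (X : VectorField J N) (x₀ : N) (y : F) : F :=
  chartDiff J x₀ ((extChartAt J x₀).symm y) (X ((extChartAt J x₀).symm y))

theorem trivializationAt_vector (X : VectorField J N) {x₀ : N} {y : F}
    (hy : y ∈ (extChartAt J x₀).target) :
    (trivializationAt F (TangentSpace J : N → Type _) x₀
      ⟨(extChartAt J x₀).symm y, X ((extChartAt J x₀).symm y)⟩).2 = fieldInChart X x₀ y := by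
  have hs : (extChartAt J x₀).symm y ∈ (chartAt G x₀).source := by
    rw [← extChartAt_source J]; exact (extChartAt J x₀).map_target hy
  have := TangentBundle.continuousLinearMapAt_trivializationAt (I := J) hs
  rw [fieldInChart, chartDiff, ← this, Bundle.Trivialization.continuousLinearMapAt_apply]
  have hs' : (extChartAt J x₀).symm y ∈
      (trivializationAt F (TangentSpace J : N → Type _) x₀).baseSet := hs
  rw [Bundle.Trivialization.coe_linearMapAt_of_mem _ hs']

theorem IsSmoothField.contDiffOn {X : VectorField J N} (hX : IsSmoothField J X) (x₀ : N) :
    ContDiffOn ℝ ∞ (fieldInChart X x₀) (extChartAt J x₀).target := by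
  have h := (Bundle.Trivialization.contMDiffOn_section_iff (IB := J) (n := ∞)
    (e := trivializationAt F (TangentSpace J : N → Type _) x₀)
      (a := (extChartAt J x₀).source) (s := X) (isOpen_extChartAt_source x₀)
      (fun x hx ↦ by simpa using hx)).1
      hX.contMDiffOn
  exact (contDiffOn_comp_chart_symm h).congr fun y hy ↦ (trivializationAt_vector X hy).symm

theorem contMDiffAt_of_chart {V : Type*} [NormedAddCommGroup V] [NormedSpace ℝ V] {f : N → V}
    {x₀ x : N} (hx : x ∈ (extChartAt J x₀).source)
    (hf : ContDiffAt ℝ ∞ (f ∘ (extChartAt J x₀).symm) (extChartAt J x₀ x)) :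
    ContMDiffAt J 𝓘(ℝ, V) ∞ f x := by
  have h' : ContMDiffAt J 𝓘(ℝ, F) ∞ (extChartAt J x₀) x :=
    contMDiffAt_extChartAt' (by rwa [← extChartAt_source J])
  refine (hf.contMDiffAt.comp x h').congr_of_eventuallyEq ?_
  filter_upwards [(isOpen_extChartAt_source x₀).mem_nhds hx] with z hz
  rw [Function.comp_apply, Function.comp_apply, (extChartAt J x₀).left_inv hz]

variable [J.Boundaryless]

theorem hasMFDerivAt_chart_symm {x₀ : N} {y : F} (hy : y ∈ (extChartAt J x₀).target) :
    HasMFDerivAt 𝓘(ℝ, F) J (extChartAt J x₀).symm y (chartLift J x₀ y) := by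
  have h := (mdifferentiableWithinAt_extChartAt_symm (I := J) hy).hasMFDerivWithinAt
  rw [chartLift]
  rw [J.range_eq_univ] at h ⊢
  exact hasMFDerivWithinAt_univ.1 h

theorem hasFDerivAt_chartChange {x₁ x₀ : N} {y : F} (hy : y ∈ (extChartAt J x₁).target)
    (hy' : (extChartAt J x₁).symm y ∈ (extChartAt J x₀).source) :
    HasFDerivAt (chartChange J x₁ x₀)
      ((chartDiff J x₀ ((extChartAt J x₁).symm y)).comp (chartLift J x₁ y)) y :=
  ((hasMFDerivAt_chart hy').comp y (hasMFDerivAt_chart_symm hy)).hasFDerivAt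

theorem contDiffAt_chartChange {x₁ x₀ : N} {y : F} (hy : y ∈ (extChartAt J x₁).target)
    (hy' : (extChartAt J x₁).symm y ∈ (extChartAt J x₀).source) :
    ContDiffAt ℝ ∞ (chartChange J x₁ x₀) y := by
  have h : ContMDiffAt 𝓘(ℝ, F) J ∞ (extChartAt J x₁).symm y :=
    (contMDiffOn_extChartAt_symm x₁).contMDiffAt ((isOpen_extChartAt_target x₁).mem_nhds hy)
  have h' : ContMDiffAt J 𝓘(ℝ, F) ∞ (extChartAt J x₀) ((extChartAt J x₁).symm y) :=
    contMDiffAt_extChartAt' (by rwa [← extChartAt_source J])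
  exact (h'.comp y h).contDiffAt

theorem formInChart_change (β : CovectorField J N) {x₁ x₀ : N} {y : F}
    (hy : y ∈ (extChartAt J x₁).target)
    (hy' : (extChartAt J x₁).symm y ∈ (extChartAt J x₀).source) :
    formInChart J β x₁ y =
      (formInChart J β x₀ (chartChange J x₁ x₀ y)).comp (fderiv ℝ (chartChange J x₁ x₀) y) := by
  ext v
  rw [(hasFDerivAt_chartChange hy hy').fderiv, formInChart_apply, covector_eq_formInChart β hy']
  rfl

theorem extDeriv_ofSubsingleton_apply {b : F → F →L[ℝ] ℝ} {y : F} (hb : DifferentiableAt ℝ b y)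
    (v w : F) :
    extDeriv (fun y ↦ ContinuousAlternatingMap.ofSubsingleton ℝ F ℝ (0 : Fin 1) (b y)) y ![v, w] =
      fderiv ℝ b y v w - fderiv ℝ b y w v := by
  have h : DifferentiableAt ℝ
      (fun y ↦ ContinuousAlternatingMap.ofSubsingleton ℝ F ℝ (0 : Fin 1) (b y)) y :=
    (ContinuousAlternatingMap.ofSubsingletonLIE (𝕜 := ℝ) (E := F) (F := ℝ)
      (0 : Fin 1)).differentiable.differentiableAt.comp y hb
  rw [extDeriv_apply h]
  have e (w v : F) : fderiv ℝ (fun y ↦ b y w) y v = fderiv ℝ b y v w := by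
    rw [fderiv_clm_apply hb (differentiableAt_const _)]
    simp
  simp [Fin.sum_univ_two, Fin.removeNth, e, sub_eq_add_neg]

/-- The exterior differential can be computed in any chart. -/
theorem extDiff_eq_fderiv (β : CovectorField J N) {x₀ x : N}
    (hx : x ∈ (extChartAt J x₀).source)
    (hβ : DifferentiableAt ℝ (formInChart J β x₀) (extChartAt J x₀ x)) (v w : TangentSpace J x) :
    extDiff J β x v w =
      fderiv ℝ (formInChart J β x₀) (extChartAt J x₀ x) (chartDiff J x₀ x v) (chartDiff J x₀ x w) -
      fderiv ℝ (formInChart J β x₀) (extChartAt J x₀ x) (chartDiff J x₀ x w)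
        (chartDiff J x₀ x v) := by
  have hxt : extChartAt J x x ∈ (extChartAt J x).target := mem_extChartAt_target x
  have hsymm : (extChartAt J x).symm (extChartAt J x x) = x := extChartAt_to_inv x
  have hτ : chartChange J x x₀ (extChartAt J x x) = extChartAt J x₀ x := by
    simp [chartChange]
  have hev : ∀ᶠ y in 𝓝 (extChartAt J x x), formInChart J β x y =
      (formInChart J β x₀ (chartChange J x x₀ y)).comp (fderiv ℝ (chartChange J x x₀) y) := by
    have h1 : ∀ᶠ y in 𝓝 (extChartAt J x x), (extChartAt J x).symm y ∈ (extChartAt J x₀).source :=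
      (hasMFDerivAt_chart_symm hxt).continuousAt.eventually_mem
        ((isOpen_extChartAt_source x₀).mem_nhds (by rwa [hsymm]))
    filter_upwards [h1, (isOpen_extChartAt_target x).mem_nhds hxt] with y hy hy'
    exact formInChart_change β hy' hy
  have hfd : fderiv ℝ (chartChange J x x₀) (extChartAt J x x) = chartDiff J x₀ x := by
    let L : F →L[ℝ] F := chartDiff J x₀ x
    have hd : HasFDerivWithinAt (chartChange J x x₀) L (Set.range J) (extChartAt J x x) :=
      (hasMFDerivAt_chart hx).2
    rw [J.range_eq_univ, hasFDerivWithinAt_univ] at hd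
    exact hd.fderiv
  have hpull : extDeriv (fun y ↦ ContinuousAlternatingMap.ofSubsingleton ℝ F ℝ (0 : Fin 1)
        (formInChart J β x y)) (extChartAt J x x) =
      (extDeriv (fun y ↦ ContinuousAlternatingMap.ofSubsingleton ℝ F ℝ (0 : Fin 1)
        (formInChart J β x₀ y)) (chartChange J x x₀ (extChartAt J x x))).compContinuousLinearMap
        (fderiv ℝ (chartChange J x x₀) (extChartAt J x x)) := by
    rw [← extDeriv_pullback (r := ∞) _
      (contDiffAt_chartChange hxt (by rwa [hsymm]))
      (by rw [minSmoothness_of_isRCLikeNormedField]; exact ENat.LEInfty.out)]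
    · refine Filter.EventuallyEq.extDeriv_eq ?_
      filter_upwards [hev] with y hy
      rw [hy]
      ext v
      rfl
    · rw [hτ]
      exact (ContinuousAlternatingMap.ofSubsingletonLIE (𝕜 := ℝ) (E := F) (F := ℝ)
        (0 : Fin 1)).differentiable.differentiableAt.comp _ hβ
  have hvec (L : F →L[ℝ] F) (v w : F) : L ∘ ![v, w] = ![L v, L w] := by
    ext i; fin_cases i <;> rfl
  have hdef : extDiff J β x v w = extDeriv (fun y ↦ ContinuousAlternatingMap.ofSubsingleton ℝ F ℝ
      (0 : Fin 1) (formInChart J β x y)) (extChartAt J x x)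
      ![chartDiff J x x v, chartDiff J x x w] := by
    rw [extDiff, J.range_eq_univ, extDerivWithin_univ]
    rfl
  rw [hdef, hpull, ContinuousAlternatingMap.compContinuousLinearMap_apply, hvec, hτ,
    extDeriv_ofSubsingleton_apply hβ, hfd]
  erw [chartDiff_self, chartDiff_self]
  rfl

theorem fderiv_comp_chart_symm {f : N → ℝ} {x₀ : N} {y : F} (hy : y ∈ (extChartAt J x₀).target)
    (hf : MDifferentiableAt J 𝓘(ℝ, ℝ) f ((extChartAt J x₀).symm y)) (v : F) :
    fderiv ℝ (f ∘ (extChartAt J x₀).symm) y v =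
      mvfderiv J f ((extChartAt J x₀).symm y) (chartLift J x₀ y v) := by
  have h : HasFDerivAt (f ∘ (extChartAt J x₀).symm)
      ((mvfderiv J f ((extChartAt J x₀).symm y)).comp (chartLift J x₀ y)) y :=
    (hf.hasMFDerivAt.comp y (hasMFDerivAt_chart_symm hy)).hasFDerivAt
  rw [h.fderiv]
  rfl

theorem mvfderiv_eq_fderiv {f : N → ℝ} {x₀ x : N} (hx : x ∈ (extChartAt J x₀).source)
    (hf : MDifferentiableAt J 𝓘(ℝ, ℝ) f x) (v : TangentSpace J x) :
    mvfderiv J f x v =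
      fderiv ℝ (f ∘ (extChartAt J x₀).symm) (extChartAt J x₀ x) (chartDiff J x₀ x v) := by
  obtain ⟨y, hy, rfl⟩ := exists_chart_point hx
  rw [(extChartAt J x₀).right_inv hy, fderiv_comp_chart_symm hy hf, chartLift_chartDiff hy]

theorem isSmoothForm_of_contDiffOn {β : CovectorField J N}
    (hβ : ∀ x₀, ContDiffOn ℝ ∞ (formInChart J β x₀) (extChartAt J x₀).target) :
    IsSmoothForm J β := by
  intro x₀
  rw [Bundle.contMDiffAt_section]
  refine contMDiffAt_of_chart (mem_extChartAt_source x₀) ?_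
  have ht := (isOpen_extChartAt_target x₀).mem_nhds (mem_extChartAt_target (I := J) x₀)
  refine ((hβ x₀).contDiffAt ht).congr_of_eventuallyEq ?_
  filter_upwards [ht] with y hy
  exact trivializationAt_covector β hy

theorem isSmoothField_of_contDiffOn {X : VectorField J N}
    (hX : ∀ x₀, ContDiffOn ℝ ∞ (fieldInChart X x₀) (extChartAt J x₀).target) :
    IsSmoothField J X := by
  intro x₀
  refine (Bundle.contMDiffAt_section (F := F) (E := (TangentSpace J : N → Type _)) x₀).2 ?_
  refine contMDiffAt_of_chart (mem_extChartAt_source x₀) ?_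
  have ht := (isOpen_extChartAt_target x₀).mem_nhds (mem_extChartAt_target (I := J) x₀)
  refine ((hX x₀).contDiffAt ht).congr_of_eventuallyEq ?_
  filter_upwards [ht] with y hy
  exact trivializationAt_vector X hy

end Charts

section TangentCharts

variable {E : Type*} [NormedAddCommGroup E] [NormedSpace ℝ E]
  {M : Type*} [TopologicalSpace M] [ChartedSpace E M] [IsManifold 𝓘(ℝ, E) ∞ M]

theorem mem_tangent_chart_source {p q : TM E M} :
    q ∈ (extChartAt 𝓘(ℝ, E).tangent p).source ↔ q.proj ∈ (extChartAt 𝓘(ℝ, E) p.proj).source := by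
  rw [extChartAt_source, extChartAt_source, TangentBundle.mem_chart_source_iff]

theorem mem_tangent_chart_target {p : TM E M} {z : E × E} :
    z ∈ (extChartAt 𝓘(ℝ, E).tangent p).target ↔ z.1 ∈ (extChartAt 𝓘(ℝ, E) p.proj).target := by
  rw [FiberBundle.extChartAt_target]
  simpa using fun h ↦ (chartAt E p.proj).map_target h

theorem tangent_chart_apply {p q : TM E M} (hq : q.proj ∈ (extChartAt 𝓘(ℝ, E) p.proj).source) :
    extChartAt 𝓘(ℝ, E).tangent p q =
      (extChartAt 𝓘(ℝ, E) p.proj q.proj, chartDiff 𝓘(ℝ, E) p.proj q.proj q.snd) := by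
  have hs : q.proj ∈ (chartAt E p.proj).source := by rwa [← extChartAt_source 𝓘(ℝ, E)]
  have hs' : q.proj ∈
      (trivializationAt E (TangentSpace 𝓘(ℝ, E) : M → Type _) p.proj).baseSet := hs
  have := TangentBundle.continuousLinearMapAt_trivializationAt (I := 𝓘(ℝ, E)) hs
  rw [chartDiff, ← this, Bundle.Trivialization.continuousLinearMapAt_apply,
    Bundle.Trivialization.coe_linearMapAt_of_mem _ hs', FiberBundle.extChartAt]
  rfl

theorem chartDiff_projDiff {p q : TM E M} (hq : q.proj ∈ (extChartAt 𝓘(ℝ, E) p.proj).source)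
    (ξ : TangentSpace 𝓘(ℝ, E).tangent q) :
    chartDiff 𝓘(ℝ, E) p.proj q.proj (projDiff q ξ) =
      (show E × E from chartDiff 𝓘(ℝ, E).tangent p q ξ).1 := by
  have h0 : MDifferentiableAt 𝓘(ℝ, E).tangent 𝓘(ℝ, E) (fun q : TM E M ↦ q.proj) q :=
    (Bundle.contMDiff_proj (n := ∞) (TangentSpace 𝓘(ℝ, E) : M → Type _)).mdifferentiable
      (by simp) q
  have h1 := (hasMFDerivAt_chart hq).comp q h0.hasMFDerivAt
  have h2 := (hasFDerivAt_fst (𝕜 := ℝ) (p := extChartAt 𝓘(ℝ, E).tangent p q)).hasMFDerivAt.comp q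
    (hasMFDerivAt_chart (mem_tangent_chart_source.2 hq))
  have h3 := h2.congr_of_eventuallyEq 
      (f₁ := extChartAt 𝓘(ℝ, E) p.proj ∘ fun q : TM E M ↦ q.proj) (by
    filter_upwards [(isOpen_extChartAt_source p).mem_nhds (mem_tangent_chart_source.2 hq)]
      with r hr
    rw [Function.comp_apply, Function.comp_apply,
      tangent_chart_apply (mem_tangent_chart_source.1 hr)])
  exact DFunLike.congr_fun (hasMFDerivAt_unique h1 h3) ξ

theorem chartDiff_mfderiv_toSection {u : VectorField 𝓘(ℝ, E) M} (hu : IsSmoothField 𝓘(ℝ, E) u)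
    {p : TM E M} {x : M} (hx : x ∈ (extChartAt 𝓘(ℝ, E) p.proj).source)
    (w : TangentSpace 𝓘(ℝ, E) x) :
    chartDiff 𝓘(ℝ, E).tangent p (toSection u x)
        (mfderiv 𝓘(ℝ, E) 𝓘(ℝ, E).tangent (toSection u) x w) =
      (chartDiff 𝓘(ℝ, E) p.proj x w, fderiv ℝ (fieldInChart u p.proj)
        (extChartAt 𝓘(ℝ, E) p.proj x) (chartDiff 𝓘(ℝ, E) p.proj x w)) := by
  obtain ⟨y, hy, rfl⟩ := exists_chart_point hx
  have hmem : toSection u ((extChartAt 𝓘(ℝ, E) p.proj).symm y) ∈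
    (extChartAt 𝓘(ℝ, E).tangent p).source := mem_tangent_chart_source.2 hx
  have h0 : MDifferentiableAt 𝓘(ℝ, E) 𝓘(ℝ, E).tangent (toSection u)
    ((extChartAt 𝓘(ℝ, E) p.proj).symm y) := hu.contMDiffAt.mdifferentiableAt (by simp)
  let L : E →L[ℝ] E × E := ((chartDiff 𝓘(ℝ, E).tangent p _).comp
    (mfderiv 𝓘(ℝ, E) 𝓘(ℝ, E).tangent (toSection u) _)).comp (chartLift 𝓘(ℝ, E) p.proj y)
  have h1 : HasFDerivAt (extChartAt 𝓘(ℝ, E).tangent p ∘ toSection u ∘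
      (extChartAt 𝓘(ℝ, E) p.proj).symm) L y :=
    (((hasMFDerivAt_chart hmem).comp _ h0.hasMFDerivAt).comp y
      (hasMFDerivAt_chart_symm hy)).hasFDerivAt
  have hnhds := (isOpen_extChartAt_target p.proj).mem_nhds hy
  have hU : DifferentiableAt ℝ (fieldInChart u p.proj) y :=
    ((hu.contDiffOn p.proj).contDiffAt hnhds).differentiableAt (by simp)
  have h2 := (hasFDerivAt_id (𝕜 := ℝ) y).prodMk hU.hasFDerivAt
  have h3 := h2.congr_of_eventuallyEq (f₁ := extChartAt 𝓘(ℝ, E).tangent p ∘ toSection u ∘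
      (extChartAt 𝓘(ℝ, E) p.proj).symm) (by
    filter_upwards [hnhds] with y' hy'
    rw [Function.comp_apply, Function.comp_apply,
      tangent_chart_apply ((extChartAt 𝓘(ℝ, E) p.proj).map_target hy')]
    exact Prod.ext ((extChartAt 𝓘(ℝ, E) p.proj).right_inv hy') rfl)
  have h4 := DFunLike.congr_fun (h1.unique h3)
    (chartDiff 𝓘(ℝ, E) p.proj ((extChartAt 𝓘(ℝ, E) p.proj).symm y) w)
  have h5 := chartLift_chartDiff hy w
  rw [(extChartAt 𝓘(ℝ, E) p.proj).right_inv hy]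
  refine Eq.trans ?_ h4
  conv_lhs => rw [← h5]
  rfl

namespace PseudoRiemannianMetric

variable (g : PseudoRiemannianMetric E M)

/-- The coordinate expression of the metric in the chart around `x₀`. -/
def inChart (x₀ : M) (y : E) : E →L[ℝ] E →L[ℝ] ℝ :=
  ((chartLift 𝓘(ℝ, E) x₀ y).precomp ℝ).comp
    ((g.inner ((extChartAt 𝓘(ℝ, E) x₀).symm y)).comp (chartLift 𝓘(ℝ, E) x₀ y))

theorem inChart_apply (x₀ : M) (y v w : E) :
    g.inChart x₀ y v w = g.inner ((extChartAt 𝓘(ℝ, E) x₀).symm y)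
      (chartLift 𝓘(ℝ, E) x₀ y v) (chartLift 𝓘(ℝ, E) x₀ y w) := rfl

theorem inChart_symm (x₀ : M) (y v w : E) : g.inChart x₀ y v w = g.inChart x₀ y w v :=
  g.symm _ _ _

theorem inner_eq_inChart {x₀ x : M} (hx : x ∈ (extChartAt 𝓘(ℝ, E) x₀).source)
    (v w : TangentSpace 𝓘(ℝ, E) x) :
    g.inner x v w = g.inChart x₀ (extChartAt 𝓘(ℝ, E) x₀ x) (chartDiff 𝓘(ℝ, E) x₀ x v)
      (chartDiff 𝓘(ℝ, E) x₀ x w) := by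
  obtain ⟨y, hy, rfl⟩ := exists_chart_point hx
  rw [(extChartAt 𝓘(ℝ, E) x₀).right_inv hy, inChart_apply, chartLift_chartDiff hy,
    chartLift_chartDiff hy]

theorem inChart_nondegenerate {x₀ : M} {y : E} (hy : y ∈ (extChartAt 𝓘(ℝ, E) x₀).target) {v : E}
    (hv : ∀ w, g.inChart x₀ y v w = 0) : v = 0 := by
  have h : chartLift 𝓘(ℝ, E) x₀ y v = 0 := g.nondegenerate _ _ fun w ↦ by
    rw [← chartLift_chartDiff hy w]
    exact hv _
  rw [← chartDiff_chartLift hy v, h, map_zero]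

theorem contDiffOn_inChart (x₀ : M) :
    ContDiffOn ℝ ∞ (g.inChart x₀) (extChartAt 𝓘(ℝ, E) x₀).target := by
  have h := (Bundle.Trivialization.contMDiffOn_section_iff (IB := 𝓘(ℝ, E)) (n := ∞)
    (e := trivializationAt (E →L[ℝ] E →L[ℝ] ℝ)
      (fun x : M ↦ TangentSpace 𝓘(ℝ, E) x →L[ℝ] TangentSpace 𝓘(ℝ, E) x →L[ℝ] ℝ) x₀)
      (a := (extChartAt 𝓘(ℝ, E) x₀).source) (s := g.inner) (isOpen_extChartAt_source x₀)
      (fun x hx ↦ by simpa using hx)).1 g.contMDiff.contMDiffOn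
  refine (contDiffOn_comp_chart_symm h).congr fun y hy ↦ ?_
  have hs : (extChartAt 𝓘(ℝ, E) x₀).symm y ∈ (chartAt E x₀).source := by
    rw [← extChartAt_source 𝓘(ℝ, E)]; exact (extChartAt 𝓘(ℝ, E) x₀).map_target hy
  have hL := TangentBundle.symmL_trivializationAt (I := 𝓘(ℝ, E)) hs
  rw [(extChartAt 𝓘(ℝ, E) x₀).right_inv hy] at hL
  ext v w
  rw [Function.comp_apply, hom_trivializationAt_apply, inChart_apply, chartLift, ← hL]
  have hs' : (extChartAt 𝓘(ℝ, E) x₀).symm y ∈ (trivializationAt (E →L[ℝ] ℝ)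
      (fun x : M ↦ TangentSpace 𝓘(ℝ, E) x →L[ℝ] ℝ) x₀).baseSet := by
    simpa using hs
  have hβ := trivializationAt_covector (fun x : M ↦ g.inner x
    ((trivializationAt E (TangentSpace 𝓘(ℝ, E) : M → Type _) x₀).symmL ℝ x v)) hy
  simp only [ContinuousLinearMap.inCoordinates, ContinuousLinearMap.comp_apply,
    Bundle.Trivialization.continuousLinearMapAt_apply,
    Bundle.Trivialization.coe_linearMapAt_of_mem _ hs']
  refine Eq.trans ?_ (DFunLike.congr_fun hβ w).symm
  rw [formInChart_apply, chartLift, ← hL]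

theorem differentiableAt_inChart {x₀ : M} {y : E} (hy : y ∈ (extChartAt 𝓘(ℝ, E) x₀).target) :
    DifferentiableAt ℝ (g.inChart x₀) y :=
  ((g.contDiffOn_inChart x₀).contDiffAt
    ((isOpen_extChartAt_target x₀).mem_nhds hy)).differentiableAt (by simp)

theorem formInChart_lower (u : VectorField 𝓘(ℝ, E) M) {x₀ : M} {y : E}
    (hy : y ∈ (extChartAt 𝓘(ℝ, E) x₀).target) :
    formInChart 𝓘(ℝ, E) (g.lower u) x₀ y = g.inChart x₀ y (fieldInChart u x₀ y) := by
  ext w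
  rw [formInChart_apply, inChart_apply, fieldInChart, chartLift_chartDiff hy, lower]

theorem formInChart_liouville {p : TM E M} {z : E × E}
    (hz : z ∈ (extChartAt 𝓘(ℝ, E).tangent p).target) :
    formInChart 𝓘(ℝ, E).tangent g.liouville p z =
      (g.inChart p.proj z.1 z.2).comp (ContinuousLinearMap.fst ℝ E E) := by
  refine ContinuousLinearMap.ext fun ζ ↦ ?_
  have hs := mem_tangent_chart_source.1 ((extChartAt 𝓘(ℝ, E).tangent p).map_target hz)
  have h := tangent_chart_apply hs
  rw [(extChartAt 𝓘(ℝ, E).tangent p).right_inv hz] at h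
  rw [formInChart_apply, liouville, ContinuousLinearMap.comp_apply, inner_eq_inChart g hs,
    chartDiff_projDiff hs, chartDiff_chartLift hz]
  rw [ContinuousLinearMap.comp_apply]
  conv_rhs => rw [h]
  rfl

theorem kinetic_eq {p q : TM E M} (hq : q.proj ∈ (extChartAt 𝓘(ℝ, E) p.proj).source) :
    g.kinetic q = (1 / 2) * g.inChart p.proj (extChartAt 𝓘(ℝ, E).tangent p q).1
      (extChartAt 𝓘(ℝ, E).tangent p q).2 (extChartAt 𝓘(ℝ, E).tangent p q).2 := by
  rw [kinetic, inner_eq_inChart g hq, tangent_chart_apply hq]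

end PseudoRiemannianMetric

end TangentCharts

section Newton

set_option maxSynthPendingDepth 3

variable {E : Type*} [NormedAddCommGroup E] [NormedSpace ℝ E]
  {M : Type*} [TopologicalSpace M] [ChartedSpace E M] [IsManifold 𝓘(ℝ, E) ∞ M]

theorem projDiff_surjective (p : TM E M) : Function.Surjective (projDiff p) := by
  intro w
  have hp := mem_extChartAt_source (I := 𝓘(ℝ, E)) p.proj
  obtain ⟨ξ, hξ⟩ := chartDiff_surjective (mem_extChartAt_source (I := 𝓘(ℝ, E).tangent) p)
    (chartDiff 𝓘(ℝ, E) p.proj p.proj w, 0)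
  refine ⟨ξ, chartDiff_injective hp ?_⟩
  rw [chartDiff_projDiff hp, hξ]

theorem projDiff_mfderiv_toSection {u : VectorField 𝓘(ℝ, E) M} (hu : IsSmoothField 𝓘(ℝ, E) u)
    (x : M) (w : TangentSpace 𝓘(ℝ, E) x) :
    projDiff (toSection u x) (mfderiv 𝓘(ℝ, E) 𝓘(ℝ, E).tangent (toSection u) x w) = w := by
  have hx := mem_extChartAt_source (I := 𝓘(ℝ, E)) x
  have hp : (toSection u x).proj ∈ (extChartAt 𝓘(ℝ, E) (toSection u x).proj).source := hx
  refine chartDiff_injective hp ?_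
  rw [chartDiff_projDiff hp, chartDiff_mfderiv_toSection hu hx]
  rfl

namespace PseudoRiemannianMetric

variable (g : PseudoRiemannianMetric E M)

theorem hasFDerivAt_inChart_apply {x₀ : M} {z : E × E}
    (hz : z.1 ∈ (extChartAt 𝓘(ℝ, E) x₀).target) :
    HasFDerivAt (fun z : E × E ↦ g.inChart x₀ z.1 z.2)
      ((g.inChart x₀ z.1).comp (ContinuousLinearMap.snd ℝ E E) +
        ((fderiv ℝ (g.inChart x₀) z.1).comp (ContinuousLinearMap.fst ℝ E E)).flip z.2) z :=
  have h : HasFDerivAt (fun z : E × E ↦ g.inChart x₀ z.1)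
      ((fderiv ℝ (g.inChart x₀) z.1).comp (ContinuousLinearMap.fst ℝ E E)) z :=
    (g.differentiableAt_inChart hz).hasFDerivAt.comp z hasFDerivAt_fst
  h.clm_apply hasFDerivAt_snd

theorem hasFDerivAt_formInChart_liouville {p : TM E M} {z : E × E}
    (hz : z.1 ∈ (extChartAt 𝓘(ℝ, E) p.proj).target) :
    HasFDerivAt (formInChart 𝓘(ℝ, E).tangent g.liouville p)
      (((ContinuousLinearMap.fst ℝ E E).precomp ℝ).comp
        ((g.inChart p.proj z.1).comp (ContinuousLinearMap.snd ℝ E E) +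
        ((fderiv ℝ (g.inChart p.proj) z.1).comp (ContinuousLinearMap.fst ℝ E E)).flip z.2)) z := by
  have h := ((ContinuousLinearMap.fst ℝ E E).precomp ℝ).hasFDerivAt.comp z
    (g.hasFDerivAt_inChart_apply hz)
  refine h.congr_of_eventuallyEq ?_
  filter_upwards [(isOpen_extChartAt_target p).mem_nhds (mem_tangent_chart_target.2 hz)]
    with z' hz'
  rw [formInChart_liouville g hz']
  rfl

theorem symplectic_eq {p₀ p : TM E M} (hp : p.proj ∈ (extChartAt 𝓘(ℝ, E) p₀.proj).source)
    (ξ η : TangentSpace 𝓘(ℝ, E).tangent p) {z X Y : E × E}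
    (hz : extChartAt 𝓘(ℝ, E).tangent p₀ p = z) (hX : chartDiff 𝓘(ℝ, E).tangent p₀ p ξ = X)
    (hY : chartDiff 𝓘(ℝ, E).tangent p₀ p η = Y) :
    g.symplectic p ξ η =
      (g.inChart p₀.proj z.1 X.2 Y.1 + fderiv ℝ (g.inChart p₀.proj) z.1 X.1 z.2 Y.1) -
      (g.inChart p₀.proj z.1 Y.2 X.1 + fderiv ℝ (g.inChart p₀.proj) z.1 Y.1 z.2 X.1) := by
  have hp' := mem_tangent_chart_source.2 hp
  have hzt : z.1 ∈ (extChartAt 𝓘(ℝ, E) p₀.proj).target := by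
    rw [← hz]; exact mem_tangent_chart_target.1 ((extChartAt 𝓘(ℝ, E).tangent p₀).map_source hp')
  have h := g.hasFDerivAt_formInChart_liouville hzt
  rw [symplectic, extDiff_eq_fderiv _ hp' (by rw [hz]; exact h.differentiableAt), hX, hY, hz,
    h.fderiv]
  rfl

theorem contDiffAt_inChart_apply_apply {x₀ : M} {z : E × E}
    (hz : z.1 ∈ (extChartAt 𝓘(ℝ, E) x₀).target) :
    ContDiffAt ℝ ∞ (fun z : E × E ↦ (1 / 2) * g.inChart x₀ z.1 z.2 z.2) z := by
  have hG : ContDiffAt ℝ ∞ (g.inChart x₀) z.1 :=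
    (g.contDiffOn_inChart x₀).contDiffAt ((isOpen_extChartAt_target x₀).mem_nhds hz)
  have hG' : ContDiffAt ℝ ∞ (fun z : E × E ↦ g.inChart x₀ z.1) z := hG.comp z contDiffAt_fst
  exact contDiffAt_const.mul ((hG'.clm_apply contDiffAt_snd).clm_apply contDiffAt_snd)

theorem kinetic_comp_chart_symm {p : TM E M} {z : E × E}
    (hz : z.1 ∈ (extChartAt 𝓘(ℝ, E) p.proj).target) :
    g.kinetic ∘ (extChartAt 𝓘(ℝ, E).tangent p).symm =ᶠ[𝓝 z]
      fun z : E × E ↦ (1 / 2) * g.inChart p.proj z.1 z.2 z.2 := by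
  filter_upwards [(isOpen_extChartAt_target p).mem_nhds (mem_tangent_chart_target.2 hz)]
    with z' hz'
  rw [Function.comp_apply, kinetic_eq g
    (mem_tangent_chart_source.1 ((extChartAt 𝓘(ℝ, E).tangent p).map_target hz')),
    (extChartAt 𝓘(ℝ, E).tangent p).right_inv hz']

theorem contMDiff_kinetic : ContMDiff 𝓘(ℝ, E).tangent 𝓘(ℝ, ℝ) ∞ g.kinetic := by
  intro p
  have hz := mem_tangent_chart_target.1 (mem_extChartAt_target (I := 𝓘(ℝ, E).tangent) p)
  exact contMDiffAt_of_chart (mem_extChartAt_source p)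
    ((g.contDiffAt_inChart_apply_apply hz).congr_of_eventuallyEq (g.kinetic_comp_chart_symm hz))

theorem mvfderiv_kinetic_eq {p₀ p : TM E M}
    (hp : p.proj ∈ (extChartAt 𝓘(ℝ, E) p₀.proj).source)
    (η : TangentSpace 𝓘(ℝ, E).tangent p) {z Y : E × E}
    (hz : extChartAt 𝓘(ℝ, E).tangent p₀ p = z) (hY : chartDiff 𝓘(ℝ, E).tangent p₀ p η = Y) :
    mvfderiv 𝓘(ℝ, E).tangent g.kinetic p η =
      (1 / 2) * fderiv ℝ (g.inChart p₀.proj) z.1 Y.1 z.2 z.2 + g.inChart p₀.proj z.1 Y.2 z.2 := by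
  have hp' := mem_tangent_chart_source.2 hp
  have hzt : z.1 ∈ (extChartAt 𝓘(ℝ, E) p₀.proj).target := by
    rw [← hz]; exact mem_tangent_chart_target.1 ((extChartAt 𝓘(ℝ, E).tangent p₀).map_source hp')
  have h := ((g.hasFDerivAt_inChart_apply hzt).clm_apply hasFDerivAt_snd).const_mul (1 / 2)
  rw [mvfderiv_eq_fderiv hp' (g.contMDiff_kinetic.mdifferentiable (by simp) p), hY, hz,
    (h.congr_of_eventuallyEq (g.kinetic_comp_chart_symm hzt)).fderiv]
  have hs := g.inChart_symm p₀.proj z.1 z.2 Y.2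
  simp [hs]
  ring

/-- The covector `w ↦ (D_v G)(v, w) - ½ (D_w G)(v, v)`, where `G` is the coordinate expression of
the metric and `z = (y, v)`. -/
def inertia (x₀ : M) (z : E × E) : E →L[ℝ] ℝ :=
  fderiv ℝ (g.inChart x₀) z.1 z.2 z.2 -
    (1 / 2 : ℝ) • ((fderiv ℝ (g.inChart x₀) z.1).flip z.2).flip z.2

theorem inertia_apply (x₀ : M) (z : E × E) (w : E) :
    g.inertia x₀ z w = fderiv ℝ (g.inChart x₀) z.1 z.2 z.2 w -
      (1 / 2) * fderiv ℝ (g.inChart x₀) z.1 w z.2 z.2 := rfl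

/-- The left hand side `i_X ω₂ + dT` of Newton's equation in coordinates. -/
theorem symplectic_add_mvfderiv_kinetic {p₀ p : TM E M}
    (hp : p.proj ∈ (extChartAt 𝓘(ℝ, E) p₀.proj).source)
    {ξ : TangentSpace 𝓘(ℝ, E).tangent p} (hξ : projDiff p ξ = p.snd)
    (η : TangentSpace 𝓘(ℝ, E).tangent p) {z X : E × E}
    (hz : extChartAt 𝓘(ℝ, E).tangent p₀ p = z) (hX : chartDiff 𝓘(ℝ, E).tangent p₀ p ξ = X) :
    g.symplectic p ξ η + mvfderiv 𝓘(ℝ, E).tangent g.kinetic p η =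
      g.inChart p₀.proj z.1 X.2 (chartDiff 𝓘(ℝ, E) p₀.proj p.proj (projDiff p η)) +
      g.inertia p₀.proj z (chartDiff 𝓘(ℝ, E) p₀.proj p.proj (projDiff p η)) := by
  obtain ⟨Y, hY⟩ : ∃ Y : E × E, chartDiff 𝓘(ℝ, E).tangent p₀ p η = Y := ⟨_, rfl⟩
  have hX1 : X.1 = z.2 := by
    have h := chartDiff_projDiff hp ξ
    rw [hX, hξ] at h
    rw [← hz, tangent_chart_apply hp]
    exact h.symm
  rw [g.symplectic_eq hp ξ η hz hX hY, g.mvfderiv_kinetic_eq hp η hz hY, chartDiff_projDiff hp η,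
    hY, inertia_apply, hX1]
  ring

theorem isInvertible_inChart [FiniteDimensional ℝ E] {x₀ : M} {y : E}
    (hy : y ∈ (extChartAt 𝓘(ℝ, E) x₀).target) : (g.inChart x₀ y).IsInvertible := by
  have hinj : Function.Injective (g.inChart x₀ y : E →ₗ[ℝ] E →L[ℝ] ℝ) := by
    rw [injective_iff_map_eq_zero]
    intro v hv
    exact g.inChart_nondegenerate hy fun w ↦ DFunLike.congr_fun hv w
  have hdim : Module.finrank ℝ E = Module.finrank ℝ (E →L[ℝ] ℝ) := by
    rw [← (LinearMap.toContinuousLinearMap (𝕜 := ℝ) (E := E) (F' := ℝ)).finrank_eq]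
    exact Subspace.dual_finrank_eq.symm
  refine ⟨(LinearEquiv.ofInjectiveOfFinrankEq _ hinj hdim).toContinuousLinearEquiv, ?_⟩
  ext v w
  rfl

/-- The acceleration prescribed by Newton's equation with the force `a`, in coordinates. -/
def acceleration (a : CovectorField 𝓘(ℝ, E) M) (x₀ : M) (z : E × E) : E :=
  (g.inChart x₀ z.1).inverse (-g.inertia x₀ z - formInChart 𝓘(ℝ, E) a x₀ z.1)

theorem eq_acceleration_iff [FiniteDimensional ℝ E] (a : CovectorField 𝓘(ℝ, E) M) {x₀ : M}
    {z : E × E} (hz : z.1 ∈ (extChartAt 𝓘(ℝ, E) x₀).target) (A : E) :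
    A = g.acceleration a x₀ z ↔
      ∀ w, g.inChart x₀ z.1 A w + g.inertia x₀ z w + formInChart 𝓘(ℝ, E) a x₀ z.1 w = 0 := by
  obtain ⟨L, hL⟩ := g.isInvertible_inChart hz
  rw [acceleration, ← hL, ContinuousLinearMap.inverse_equiv]
  have h : A = L.symm (-g.inertia x₀ z - formInChart 𝓘(ℝ, E) a x₀ z.1) ↔
      L A = -g.inertia x₀ z - formInChart 𝓘(ℝ, E) a x₀ z.1 := L.toEquiv.eq_symm_apply
  refine h.trans ?_
  rw [ContinuousLinearMap.ext_iff]
  refine forall_congr' fun w ↦ ?_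
  simp only [sub_apply, neg_apply,
    ContinuousLinearEquiv.coe_coe]
  constructor <;> intro h <;> linarith

/-- Newton's equation at a point, in coordinates. -/
theorem newton_iff [FiniteDimensional ℝ E] (a : CovectorField 𝓘(ℝ, E) M) {p₀ p : TM E M}
    (hp : p.proj ∈ (extChartAt 𝓘(ℝ, E) p₀.proj).source)
    {ξ : TangentSpace 𝓘(ℝ, E).tangent p} (hξ : projDiff p ξ = p.snd) {z X : E × E}
    (hz : extChartAt 𝓘(ℝ, E).tangent p₀ p = z) (hX : chartDiff 𝓘(ℝ, E).tangent p₀ p ξ = X) :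
    (∀ η, g.symplectic p ξ η + mvfderiv 𝓘(ℝ, E).tangent g.kinetic p η +
      a p.proj (projDiff p η) = 0) ↔ X.2 = g.acceleration a p₀.proj z := by
  have hz1 : extChartAt 𝓘(ℝ, E) p₀.proj p.proj = z.1 := by rw [← hz, tangent_chart_apply hp]
  have hzt : z.1 ∈ (extChartAt 𝓘(ℝ, E) p₀.proj).target := by
    rw [← hz1]; exact (extChartAt 𝓘(ℝ, E) p₀.proj).map_source hp
  have key (η : TangentSpace 𝓘(ℝ, E).tangent p) :
      g.symplectic p ξ η + mvfderiv 𝓘(ℝ, E).tangent g.kinetic p η + a p.proj (projDiff p η) =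
      g.inChart p₀.proj z.1 X.2 (chartDiff 𝓘(ℝ, E) p₀.proj p.proj (projDiff p η)) +
      g.inertia p₀.proj z (chartDiff 𝓘(ℝ, E) p₀.proj p.proj (projDiff p η)) +
      formInChart 𝓘(ℝ, E) a p₀.proj z.1
        (chartDiff 𝓘(ℝ, E) p₀.proj p.proj (projDiff p η)) := by
    rw [g.symplectic_add_mvfderiv_kinetic hp hξ η hz hX, covector_eq_formInChart a hp, hz1]
  rw [g.eq_acceleration_iff a hzt]
  constructor
  · intro h w
    obtain ⟨w, rfl⟩ := chartDiff_surjective hp w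
    obtain ⟨η, rfl⟩ := projDiff_surjective p w
    rw [← key]
    exact h η
  · intro h η
    rw [key]
    exact h _

/-- The second order differential equation of the mechanical system with the force `a`. -/
def motion (a : CovectorField 𝓘(ℝ, E) M) : VectorField 𝓘(ℝ, E).tangent (TM E M) :=
  fun p ↦ chartLift 𝓘(ℝ, E).tangent p (extChartAt 𝓘(ℝ, E).tangent p p)
    ((extChartAt 𝓘(ℝ, E).tangent p p).2,
      g.acceleration a p.proj (extChartAt 𝓘(ℝ, E).tangent p p))

theorem chartDiff_motion (a : CovectorField 𝓘(ℝ, E) M) (p : TM E M) :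
    chartDiff 𝓘(ℝ, E).tangent p p (g.motion a p) = ((extChartAt 𝓘(ℝ, E).tangent p p).2,
      g.acceleration a p.proj (extChartAt 𝓘(ℝ, E).tangent p p)) := by
  have h := chartDiff_chartLift (mem_extChartAt_target (I := 𝓘(ℝ, E).tangent) p)
    ((extChartAt 𝓘(ℝ, E).tangent p p).2,
      g.acceleration a p.proj (extChartAt 𝓘(ℝ, E).tangent p p))
  rw [extChartAt_to_inv] at h
  exact h

theorem projDiff_motion (a : CovectorField 𝓘(ℝ, E) M) (p : TM E M) :
    projDiff p (g.motion a p) = p.snd := by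
  have hp := mem_extChartAt_source (I := 𝓘(ℝ, E)) p.proj
  refine chartDiff_injective hp ?_
  rw [chartDiff_projDiff hp, chartDiff_motion]
  rw [tangent_chart_apply hp]

theorem motion_newton [FiniteDimensional ℝ E] (a : CovectorField 𝓘(ℝ, E) M) (p : TM E M)
    (η : TangentSpace 𝓘(ℝ, E).tangent p) :
    g.symplectic p (g.motion a p) η + mvfderiv 𝓘(ℝ, E).tangent g.kinetic p η +
      a p.proj (projDiff p η) = 0 :=
  (g.newton_iff a (mem_extChartAt_source p.proj) (g.projDiff_motion a p) rfl
    (g.chartDiff_motion a p)).2 rfl η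

theorem fieldInChart_motion [FiniteDimensional ℝ E] (a : CovectorField 𝓘(ℝ, E) M) {p₀ : TM E M}
    {z : E × E} (hz : z ∈ (extChartAt 𝓘(ℝ, E).tangent p₀).target) :
    fieldInChart (g.motion a) p₀ z = (z.2, g.acceleration a p₀.proj z) := by
  have hp := mem_tangent_chart_source.1 ((extChartAt 𝓘(ℝ, E).tangent p₀).map_target hz)
  have hpz := (extChartAt 𝓘(ℝ, E).tangent p₀).right_inv hz
  have h2 := (g.newton_iff a hp (g.projDiff_motion a _) hpz rfl).1 (g.motion_newton a _)
  refine Prod.ext ?_ h2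
  have h1 := chartDiff_projDiff hp (g.motion a _)
  rw [projDiff_motion] at h1
  refine h1.symm.trans ?_
  rw [tangent_chart_apply hp] at hpz
  exact congrArg Prod.snd hpz

theorem contDiffOn_inertia [FiniteDimensional ℝ E] (x₀ : M) :
    ContDiffOn ℝ ∞ (g.inertia x₀) ((extChartAt 𝓘(ℝ, E) x₀).target ×ˢ Set.univ) := by
  have hdG : ContDiffOn ℝ ∞ (fderiv ℝ (g.inChart x₀)) (extChartAt 𝓘(ℝ, E) x₀).target :=
    (g.contDiffOn_inChart x₀).fderiv_of_isOpen (isOpen_extChartAt_target x₀) (by simp)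
  have hd : ContDiffOn ℝ ∞ (fun z : E × E ↦ fderiv ℝ (g.inChart x₀) z.1)
      ((extChartAt 𝓘(ℝ, E) x₀).target ×ˢ Set.univ) :=
    hdG.comp contDiffOn_fst fun z hz ↦ hz.1
  rw [contDiffOn_clm_apply]
  intro w
  simp only [inertia_apply]
  exact (((hd.clm_apply contDiffOn_snd).clm_apply contDiffOn_snd).clm_apply contDiffOn_const).sub
    (contDiffOn_const.mul (((hd.clm_apply contDiffOn_const).clm_apply contDiffOn_snd).clm_apply
      contDiffOn_snd))

theorem contDiffOn_acceleration [FiniteDimensional ℝ E] {a : CovectorField 𝓘(ℝ, E) M}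
    (ha : IsSmoothForm 𝓘(ℝ, E) a) (x₀ : M) :
    ContDiffOn ℝ ∞ (g.acceleration a x₀) ((extChartAt 𝓘(ℝ, E) x₀).target ×ˢ Set.univ) := by
  have := FiniteDimensional.complete ℝ E
  have hG : ContDiffOn ℝ ∞ (fun z : E × E ↦ (g.inChart x₀ z.1).inverse)
      ((extChartAt 𝓘(ℝ, E) x₀).target ×ˢ Set.univ) := by
    intro z hz
    have h1 := (g.isInvertible_inChart hz.1).contDiffAt_map_inverse (n := ∞)
    have h2 := ((g.contDiffOn_inChart x₀).comp contDiffOn_fst fun z hz ↦ hz.1) z hz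
    exact h1.comp_contDiffWithinAt z h2
  have ha' : ContDiffOn ℝ ∞ (fun z : E × E ↦ formInChart 𝓘(ℝ, E) a x₀ z.1)
      ((extChartAt 𝓘(ℝ, E) x₀).target ×ˢ Set.univ) :=
    (ha.contDiffOn x₀).comp contDiffOn_fst fun z hz ↦ hz.1
  exact hG.clm_apply ((g.contDiffOn_inertia x₀).neg.sub ha')

theorem isSecondOrderEquation_motion [FiniteDimensional ℝ E] {a : CovectorField 𝓘(ℝ, E) M}
    (ha : IsSmoothForm 𝓘(ℝ, E) a) : IsSecondOrderEquation (g.motion a) where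
  smooth := by
    refine isSmoothField_of_contDiffOn fun p ↦ ?_
    have h : ContDiffOn ℝ ∞ (fun z : E × E ↦ (z.2, g.acceleration a p.proj z))
        (extChartAt 𝓘(ℝ, E).tangent p).target :=
      contDiffOn_snd.prodMk ((g.contDiffOn_acceleration ha p.proj).mono
        fun z hz ↦ ⟨mem_tangent_chart_target.1 hz, trivial⟩)
    exact h.congr fun z hz ↦ g.fieldInChart_motion a hz
  second_order := g.projDiff_motion a

end PseudoRiemannianMetric

end Newton

section IntermediateIntegral

set_option maxSynthPendingDepth 3

variable {E : Type*} [NormedAddCommGroup E] [NormedSpace ℝ E]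
  {M : Type*} [TopologicalSpace M] [ChartedSpace E M] [IsManifold 𝓘(ℝ, E) ∞ M]

/-- The pull-back to `TM` of a field of covectors on `M`. -/
def pullbackProj (a : CovectorField 𝓘(ℝ, E) M) : CovectorField 𝓘(ℝ, E).tangent (TM E M) :=
  fun p ↦ (a p.proj).comp (projDiff p)

theorem formInChart_pullbackProj (a : CovectorField 𝓘(ℝ, E) M) {p : TM E M} {z : E × E}
    (hz : z ∈ (extChartAt 𝓘(ℝ, E).tangent p).target) :
    formInChart 𝓘(ℝ, E).tangent (pullbackProj a) p z =
      (formInChart 𝓘(ℝ, E) a p.proj z.1).comp (ContinuousLinearMap.fst ℝ E E) := by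
  refine ContinuousLinearMap.ext fun ζ ↦ ?_
  have hs := mem_tangent_chart_source.1 ((extChartAt 𝓘(ℝ, E).tangent p).map_target hz)
  have h := tangent_chart_apply hs
  rw [(extChartAt 𝓘(ℝ, E).tangent p).right_inv hz] at h
  rw [formInChart_apply, pullbackProj, ContinuousLinearMap.comp_apply,
    covector_eq_formInChart a hs, chartDiff_projDiff hs, chartDiff_chartLift hz]
  rw [ContinuousLinearMap.comp_apply]
  conv_rhs => rw [h]
  rfl

theorem isForceForm_pullbackProj {a : CovectorField 𝓘(ℝ, E) M} (ha : IsSmoothForm 𝓘(ℝ, E) a) :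
    IsForceForm (pullbackProj a) where
  smooth := by
    refine isSmoothForm_of_contDiffOn fun p ↦ ?_
    have h : ContDiffOn ℝ ∞ (fun z : E × E ↦ (formInChart 𝓘(ℝ, E) a p.proj z.1).comp
        (ContinuousLinearMap.fst ℝ E E)) (extChartAt 𝓘(ℝ, E).tangent p).target :=
      ((ha.contDiffOn p.proj).comp contDiffOn_fst
        fun z hz ↦ mem_tangent_chart_target.1 hz).clm_comp contDiffOn_const
    exact h.congr fun z hz ↦ formInChart_pullbackProj a hz
  horizontal p ξ hξ := by
    rw [pullbackProj, ContinuousLinearMap.comp_apply, hξ, map_zero]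

namespace PseudoRiemannianMetric

variable (g : PseudoRiemannianMetric E M) {u : VectorField 𝓘(ℝ, E) M}

theorem hasFDerivAt_inChart_field (hu : IsSmoothField 𝓘(ℝ, E) u) {x₀ : M} {y : E}
    (hy : y ∈ (extChartAt 𝓘(ℝ, E) x₀).target) :
    HasFDerivAt (fun y ↦ g.inChart x₀ y (fieldInChart u x₀ y))
      ((g.inChart x₀ y).comp (fderiv ℝ (fieldInChart u x₀) y) +
        (fderiv ℝ (g.inChart x₀) y).flip (fieldInChart u x₀ y)) y :=
  (g.differentiableAt_inChart hy).hasFDerivAt.clm_apply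
    (((hu.contDiffOn x₀).contDiffAt
      ((isOpen_extChartAt_target x₀).mem_nhds hy)).differentiableAt (by simp)).hasFDerivAt

theorem contDiffOn_inChart_field (hu : IsSmoothField 𝓘(ℝ, E) u) (x₀ : M) :
    ContDiffOn ℝ ∞ (fun y ↦ g.inChart x₀ y (fieldInChart u x₀ y))
      (extChartAt 𝓘(ℝ, E) x₀).target :=
  (g.contDiffOn_inChart x₀).clm_apply (hu.contDiffOn x₀)

theorem formInChart_lower_eventuallyEq {x₀ : M} {y : E}
    (hy : y ∈ (extChartAt 𝓘(ℝ, E) x₀).target) :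
    formInChart 𝓘(ℝ, E) (g.lower u) x₀ =ᶠ[𝓝 y]
      fun y ↦ g.inChart x₀ y (fieldInChart u x₀ y) := by
  filter_upwards [(isOpen_extChartAt_target x₀).mem_nhds hy] with y' hy'
  exact g.formInChart_lower u hy'

theorem extDiff_lower_eq (hu : IsSmoothField 𝓘(ℝ, E) u) {x₀ x : M}
    (hx : x ∈ (extChartAt 𝓘(ℝ, E) x₀).source) (v w : TangentSpace 𝓘(ℝ, E) x) :
    extDiff 𝓘(ℝ, E) (g.lower u) x v w =
      fderiv ℝ (fun y ↦ g.inChart x₀ y (fieldInChart u x₀ y)) (extChartAt 𝓘(ℝ, E) x₀ x)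
        (chartDiff 𝓘(ℝ, E) x₀ x v) (chartDiff 𝓘(ℝ, E) x₀ x w) -
      fderiv ℝ (fun y ↦ g.inChart x₀ y (fieldInChart u x₀ y)) (extChartAt 𝓘(ℝ, E) x₀ x)
        (chartDiff 𝓘(ℝ, E) x₀ x w) (chartDiff 𝓘(ℝ, E) x₀ x v) := by
  have hy := (extChartAt 𝓘(ℝ, E) x₀).map_source hx
  have he := g.formInChart_lower_eventuallyEq (u := u) hy
  rw [extDiff_eq_fderiv _ hx
    ((g.hasFDerivAt_inChart_field hu hy).congr_of_eventuallyEq he).differentiableAt, he.fderiv_eq]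

theorem contMDiff_kinetic_toSection (hu : IsSmoothField 𝓘(ℝ, E) u) :
    ContMDiff 𝓘(ℝ, E) 𝓘(ℝ, ℝ) ∞ (fun x ↦ g.kinetic (toSection u x)) :=
  g.contMDiff_kinetic.comp hu

theorem kinetic_toSection_chart_symm {x₀ : M} {y : E}
    (hy : y ∈ (extChartAt 𝓘(ℝ, E) x₀).target) :
    g.kinetic (toSection u ((extChartAt 𝓘(ℝ, E) x₀).symm y)) =
      (1 / 2) * g.inChart x₀ y (fieldInChart u x₀ y) (fieldInChart u x₀ y) := by
  rw [kinetic]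
  have h := g.inner_eq_inChart ((extChartAt 𝓘(ℝ, E) x₀).map_target hy)
    (u ((extChartAt 𝓘(ℝ, E) x₀).symm y)) (u ((extChartAt 𝓘(ℝ, E) x₀).symm y))
  rw [(extChartAt 𝓘(ℝ, E) x₀).right_inv hy] at h
  exact congrArg _ h

theorem mvfderiv_kinetic_toSection_eq (hu : IsSmoothField 𝓘(ℝ, E) u) {x₀ x : M}
    (hx : x ∈ (extChartAt 𝓘(ℝ, E) x₀).source) (w : TangentSpace 𝓘(ℝ, E) x) :
    mvfderiv 𝓘(ℝ, E) (fun x ↦ g.kinetic (toSection u x)) x w =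
      fderiv ℝ (fun y ↦ (1 / 2) * g.inChart x₀ y (fieldInChart u x₀ y) (fieldInChart u x₀ y))
        (extChartAt 𝓘(ℝ, E) x₀ x) (chartDiff 𝓘(ℝ, E) x₀ x w) := by
  rw [mvfderiv_eq_fderiv hx ((g.contMDiff_kinetic_toSection hu).mdifferentiable (by simp) x)]
  congr 1
  refine Filter.EventuallyEq.fderiv_eq ?_
  filter_upwards [(isOpen_extChartAt_target x₀).mem_nhds
    ((extChartAt 𝓘(ℝ, E) x₀).map_source hx)] with y hy
  exact g.kinetic_toSection_chart_symm hy

variable (u) in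
/-- The 1-form `-i_u d(i_u T₂) - d(T(u))` on `M`. -/
def integralForce : CovectorField 𝓘(ℝ, E) M :=
  fun x ↦
    -(fderiv ℝ (fun y ↦ g.inChart x y (fieldInChart u x y)) (extChartAt 𝓘(ℝ, E) x x)
        (chartDiff 𝓘(ℝ, E) x x (u x)) -
      (fderiv ℝ (fun y ↦ g.inChart x y (fieldInChart u x y)) (extChartAt 𝓘(ℝ, E) x x)).flip
        (chartDiff 𝓘(ℝ, E) x x (u x))).comp (chartDiff 𝓘(ℝ, E) x x) -
    mvfderiv 𝓘(ℝ, E) (fun x ↦ g.kinetic (toSection u x)) x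

theorem integralForce_apply (hu : IsSmoothField 𝓘(ℝ, E) u) (x : M) (w : TangentSpace 𝓘(ℝ, E) x) :
    g.integralForce u x w = -extDiff 𝓘(ℝ, E) (g.lower u) x (u x) w -
      mvfderiv 𝓘(ℝ, E) (fun x ↦ g.kinetic (toSection u x)) x w := by
  rw [g.extDiff_lower_eq hu (mem_extChartAt_source x)]
  rfl

theorem formInChart_integralForce (hu : IsSmoothField 𝓘(ℝ, E) u) {x₀ : M} {y : E}
    (hy : y ∈ (extChartAt 𝓘(ℝ, E) x₀).target) (w : E) :
    formInChart 𝓘(ℝ, E) (g.integralForce u) x₀ y w =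
      -(fderiv ℝ (fun y ↦ g.inChart x₀ y (fieldInChart u x₀ y)) y (fieldInChart u x₀ y) w -
        fderiv ℝ (fun y ↦ g.inChart x₀ y (fieldInChart u x₀ y)) y w (fieldInChart u x₀ y)) -
      fderiv ℝ (fun y ↦ (1 / 2) * g.inChart x₀ y (fieldInChart u x₀ y) (fieldInChart u x₀ y))
        y w := by
  have hs := (extChartAt 𝓘(ℝ, E) x₀).map_target hy
  rw [formInChart_apply, g.integralForce_apply hu, g.extDiff_lower_eq hu hs,
    g.mvfderiv_kinetic_toSection_eq hu hs, chartDiff_chartLift hy,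
    (extChartAt 𝓘(ℝ, E) x₀).right_inv hy]
  rfl

theorem isSmoothForm_integralForce [FiniteDimensional ℝ E] (hu : IsSmoothField 𝓘(ℝ, E) u) :
    IsSmoothForm 𝓘(ℝ, E) (g.integralForce u) := by
  refine isSmoothForm_of_contDiffOn fun x₀ ↦ ?_
  rw [contDiffOn_clm_apply]
  intro w
  have ho := isOpen_extChartAt_target (I := 𝓘(ℝ, E)) x₀
  have hU := hu.contDiffOn x₀
  have hb := g.contDiffOn_inChart_field hu x₀
  have hdb := hb.fderiv_of_isOpen (m := ∞) ho (by simp)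
  have hdk := (contDiffOn_const (c := (1 / 2 : ℝ)).mul (hb.clm_apply hU)).fderiv_of_isOpen
    (m := ∞) ho (by simp)
  exact ((((hdb.clm_apply hU).clm_apply contDiffOn_const).sub
    ((hdb.clm_apply contDiffOn_const).clm_apply hU)).neg.sub
      (hdk.clm_apply contDiffOn_const)).congr fun y hy ↦ g.formInChart_integralForce hu hy w

/-- Newton's equation holds for the force `integralForce` and the vectors `u_* u_x`. -/
theorem integralForce_newton (hu : IsSmoothField 𝓘(ℝ, E) u) (x : M)
    (η : TangentSpace 𝓘(ℝ, E).tangent (toSection u x)) :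
    g.symplectic (toSection u x)
        (mfderiv 𝓘(ℝ, E) 𝓘(ℝ, E).tangent (toSection u) x (u x)) η +
      mvfderiv 𝓘(ℝ, E).tangent g.kinetic (toSection u x) η +
      g.integralForce u x (projDiff (toSection u x) η) = 0 := by
  have hx := mem_extChartAt_source (I := 𝓘(ℝ, E)) x
  have hp : (toSection u x).proj ∈ (extChartAt 𝓘(ℝ, E) (toSection u x).proj).source := hx
  have hy := (extChartAt 𝓘(ℝ, E) x).map_source hx
  have hU : chartDiff 𝓘(ℝ, E) x x (u x) = fieldInChart u x (extChartAt 𝓘(ℝ, E) x x) := by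
    rw [fieldInChart, extChartAt_to_inv]
  have hz : extChartAt 𝓘(ℝ, E).tangent (toSection u x) (toSection u x) =
      (extChartAt 𝓘(ℝ, E) x x, fieldInChart u x (extChartAt 𝓘(ℝ, E) x x)) := by
    rw [tangent_chart_apply hp, ← hU]
    rfl
  have hX : chartDiff 𝓘(ℝ, E).tangent (toSection u x) (toSection u x)
      (mfderiv 𝓘(ℝ, E) 𝓘(ℝ, E).tangent (toSection u) x (u x)) =
      (fieldInChart u x (extChartAt 𝓘(ℝ, E) x x),
        fderiv ℝ (fieldInChart u x) (extChartAt 𝓘(ℝ, E) x x)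
          (fieldInChart u x (extChartAt 𝓘(ℝ, E) x x))) := by
    rw [← hU]
    exact chartDiff_mfderiv_toSection hu (p := toSection u x) hx (u x)
  have hb := g.hasFDerivAt_inChart_field hu hy
  have hU' : HasFDerivAt (fieldInChart u x) _ (extChartAt 𝓘(ℝ, E) x x) :=
    (((hu.contDiffOn x).contDiffAt
      ((isOpen_extChartAt_target x).mem_nhds hy)).differentiableAt (by simp)).hasFDerivAt
  have hk := (hb.clm_apply hU').const_mul (1 / 2)
  have key (w : E) : g.inChart x (extChartAt 𝓘(ℝ, E) x x)
        (fderiv ℝ (fieldInChart u x) (extChartAt 𝓘(ℝ, E) x x)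
          (fieldInChart u x (extChartAt 𝓘(ℝ, E) x x))) w +
      g.inertia x (extChartAt 𝓘(ℝ, E) x x, fieldInChart u x (extChartAt 𝓘(ℝ, E) x x)) w +
      formInChart 𝓘(ℝ, E) (g.integralForce u) x (extChartAt 𝓘(ℝ, E) x x) w = 0 := by
    rw [g.formInChart_integralForce hu hy, hb.fderiv, hk.fderiv, inertia_apply]
    have hs := g.inChart_symm x (extChartAt 𝓘(ℝ, E) x x)
      (fieldInChart u x (extChartAt 𝓘(ℝ, E) x x))
      (fderiv ℝ (fieldInChart u x) (extChartAt 𝓘(ℝ, E) x x) w)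
    simp only [add_apply, smul_apply, smul_eq_mul, ContinuousLinearMap.comp_apply,
      ContinuousLinearMap.flip_apply, hs]
    ring
  exact (congrArg₂ (· + ·)
    (g.symplectic_add_mvfderiv_kinetic hp (projDiff_mfderiv_toSection hu x (u x)) η hz hX)
    (covector_eq_formInChart (g.integralForce u) hx (projDiff (toSection u x) η))).trans (key _)

theorem isIntermediateIntegralOfSystem_integralForce [FiniteDimensional ℝ E]
    (hu : IsSmoothField 𝓘(ℝ, E) u) :
    g.IsIntermediateIntegralOfSystem (pullbackProj (g.integralForce u)) u := by
  have ha := g.isSmoothForm_integralForce hu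
  refine ⟨g.motion (g.integralForce u), ⟨g.isSecondOrderEquation_motion ha,
    g.motion_newton _⟩, fun x ↦ ⟨u x, ?_⟩⟩
  have hp : (toSection u x).proj ∈ (extChartAt 𝓘(ℝ, E) (toSection u x).proj).source :=
    mem_extChartAt_source x
  have h1 := (g.newton_iff (g.integralForce u) hp (g.projDiff_motion _ _) rfl rfl).1
    (g.motion_newton _ _)
  have h2 := (g.newton_iff (g.integralForce u) hp (projDiff_mfderiv_toSection hu x (u x)) rfl
    rfl).1 (g.integralForce_newton hu x)
  refine chartDiff_injective (mem_extChartAt_source (I := 𝓘(ℝ, E).tangent) (toSection u x)) ?_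
  refine Prod.ext ?_ (h1.trans h2.symm)
  refine (chartDiff_projDiff hp _).symm.trans (Eq.trans ?_ (chartDiff_projDiff hp _))
  rw [projDiff_motion, projDiff_mfderiv_toSection hu]
  rfl

theorem newton_of_isIntermediateIntegralOfSystem (hu : IsSmoothField 𝓘(ℝ, E) u)
    {β : CovectorField 𝓘(ℝ, E).tangent (TM E M)} (h : g.IsIntermediateIntegralOfSystem β u)
    (x : M) (η : TangentSpace 𝓘(ℝ, E).tangent (toSection u x)) :
    g.symplectic (toSection u x)
        (mfderiv 𝓘(ℝ, E) 𝓘(ℝ, E).tangent (toSection u) x (u x)) η +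
      mvfderiv 𝓘(ℝ, E).tangent g.kinetic (toSection u x) η + β (toSection u x) η = 0 := by
  obtain ⟨D, hD, hDu⟩ := h
  obtain ⟨w, hw⟩ := hDu x
  have hwu : w = u x := by
    rw [← projDiff_mfderiv_toSection hu x w, ← hw, hD.isSecondOrderEquation.second_order]
    rfl
  rw [← hwu, ← hw]
  exact hD.newton _ η

theorem eq_integralForce (hu : IsSmoothField 𝓘(ℝ, E) u)
    {β : CovectorField 𝓘(ℝ, E).tangent (TM E M)} (hβ : IsVelocityIndependent β)
    (h : g.IsIntermediateIntegralOfSystem β u) : β = pullbackProj (g.integralForce u) := by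
  obtain ⟨b, -, hb⟩ := hβ
  have hx (x : M) (w : TangentSpace 𝓘(ℝ, E) x) : b x w = g.integralForce u x w := by
    obtain ⟨η, rfl⟩ := projDiff_surjective (toSection u x) w
    have h1 := g.newton_of_isIntermediateIntegralOfSystem hu h x η
    have h2 := g.integralForce_newton hu x η
    rw [hb] at h1
    exact add_left_cancel (h1.trans h2.symm)
  funext p
  ext ξ
  rw [hb, hx]
  rfl

end PseudoRiemannianMetric

end IntermediateIntegral

end Mechanics

end

theorem mainTheorem2 {E : Type*} [NormedAddCommGroup E] [NormedSpace ℝ E] [FiniteDimensional ℝ E]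
    {M : Type*} [TopologicalSpace M] [ChartedSpace E M] [IsManifold 𝓘(ℝ, E) ∞ M]
    (g : Mechanics.PseudoRiemannianMetric E M)
    (u : Mechanics.VectorField 𝓘(ℝ, E) M) (hu : Mechanics.IsSmoothField 𝓘(ℝ, E) u) :
    ∃ α : Mechanics.CovectorField 𝓘(ℝ, E).tangent (Mechanics.TM E M),
      (Mechanics.IsForceForm α ∧ Mechanics.IsVelocityIndependent α ∧
        g.IsIntermediateIntegralOfSystem α u) ∧
      (∀ β : Mechanics.CovectorField 𝓘(ℝ, E).tangent (Mechanics.TM E M),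
        Mechanics.IsForceForm β → Mechanics.IsVelocityIndependent β →
          g.IsIntermediateIntegralOfSystem β u → β = α) ∧
      ∀ (p : Mechanics.TM E M) (ξ : TangentSpace 𝓘(ℝ, E).tangent p),
        α p ξ =
          - Mechanics.extDiff 𝓘(ℝ, E) (g.lower u) p.proj (u p.proj) (Mechanics.projDiff p ξ)
          - mvfderiv 𝓘(ℝ, E) (fun x ↦ g.kinetic (Mechanics.toSection u x)) p.proj
              (Mechanics.projDiff p ξ) := by
  have ha := g.isSmoothForm_integralForce hu
  exact ⟨Mechanics.pullbackProj (g.integralForce u),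
    ⟨Mechanics.isForceForm_pullbackProj ha, ⟨_, ha, fun _ _ ↦ rfl⟩,
      g.isIntermediateIntegralOfSystem_integralForce hu⟩,
    fun _ _ hβ h ↦ g.eq_integralForce hu hβ h,
    fun p ξ ↦ g.integralForce_apply hu p.proj (Mechanics.projDiff p ξ)⟩
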